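/- Let $(W,S)$ be a Coxeter system with $S=\{s_1,\dots,s_n\}$ finite and Coxeter matrix $(m_{ij})$, and suppose it is simply laced, i.e. $m_{ij}\in\{2,3\}$ for all $i\neq j$. Let $\Gamma=(V,E)$ be its Coxeter graph: the vertices are the generators, and $s_i,s_j$ ($i\ne j$) are joined by an edge if and only if $m_{ij}\neq 2$. Let $\bar E$ be the set of directed edges of $\Gamma$, and let $f:\bar E\to\{+1,-1\}$ satisfy $f((s_i,s_j))=f((s_j,s_i))^{-1}$, so that $\Gamma_f=(V,E,f)$ is a signed Coxeter graph. Let $\omega_i$ be the $n\times n$ complex matrix which differs from the identity matrix only in its $i$-th row; this row has $-1$ in position $(i,i)$, has $f((s_i,s_j))\cdot 2\cos(\pi/m_{ij})$ in position $(i,j)$ if $s_i$ and $s_j$ are joined by an edge, and has $0$ in the other positions. The matrices $\omega_i$ satisfy the Coxeter relations; let $\mathcal R_{\Gamma,f}:W\to GL_n(\mathbb C)$ be the group homomorphism with $\mathcal R_{\Gamma,f}(s_i)=\omega_i$ for all $i$ (the generalized geometric representation). The graph $\Gamma_f$ is called balanced if for every closed path in $\Gamma$ (vertices and edges may be repeated)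 the product of the weights of its directed edges equals $1$. Then the representation $\mathcal R_{\Gamma,f}$ is faithful (injective) if and only if $\Gamma_f$ is balanced. Moreover, $\Gamma_f$ is balanced if and only if the product of the weights along every cycle of $\Gamma$ is $+1$, and if and only if every cycle of $\Gamma$ contains an even number of edges of weight $-1$. -/

import Mathlib

/-- The Coxeter graph of a Coxeter matrix: two distinct generators are joined by an edge exactly
when `M i j ≠ 2`, that is, when `m_{ij} ≥ 3` or `m_{ij} = ∞` (encoded in Mathlib as `0`). -/
def CoxeterMatrix.coxeterGraph {B : Type*} (M : CoxeterMatrix B) : SimpleGraph B where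
  Adj i j := i ≠ j ∧ M i j ≠ 2
  symm := ⟨fun i j h => ⟨h.1.symm, by rw [M.symmetric j i]; exact h.2⟩⟩
  loopless := ⟨fun _ h => h.1 rfl⟩

/-- A Coxeter matrix is simply laced if all its off-diagonal entries are `2` or `3`. -/
def CoxeterMatrix.IsSimplyLaced {B : Type*} (M : CoxeterMatrix B) : Prop :=
  ∀ i j : B, i ≠ j → M i j = 2 ∨ M i j = 3

/-- A legal weight function: a map from the directed edges of the Coxeter graph to the nonzero
complex numbers which takes inverse values on opposite directed edges.  Together with the Coxeter
graph it forms a weighted Coxeter graph. -/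
structure LegalWeight {B : Type*} (M : CoxeterMatrix B) where
  /-- The weight of a directed edge. -/
  weight : M.coxeterGraph.Dart → ℂˣ
  weight_symm : ∀ d : M.coxeterGraph.Dart, weight d.symm = (weight d)⁻¹

namespace LegalWeight

variable {B : Type*} {M : CoxeterMatrix B}

/-- The weighted Coxeter graph given by `f` is a signed Coxeter graph: the Coxeter system is simply
laced and all weights are `1` or `-1`. -/
def IsSigned (f : LegalWeight M) : Prop :=
  M.IsSimplyLaced ∧ ∀ d : M.coxeterGraph.Dart, f.weight d = 1 ∨ f.weight d = -1

/-- The weight of a path (which may repeat vertices and edges): the product of the weights of its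
directed edges. -/
def walkWeight (f : LegalWeight M) {i j : B} (p : M.coxeterGraph.Walk i j) : ℂˣ :=
  (p.darts.map f.weight).prod

/-- A weighted Coxeter graph is balanced if every closed path has weight `1`. -/
def IsBalanced (f : LegalWeight M) : Prop :=
  ∀ (i : B) (p : M.coxeterGraph.Walk i i), f.walkWeight p = 1

open Classical in
/-- The number of edges of weight `-1` along a path, counted with multiplicity. -/
noncomputable def negCount (f : LegalWeight M) {i j : B} (p : M.coxeterGraph.Walk i j) : ℕ :=
  p.darts.countP (fun d => f.weight d = -1)

open Classical in
/-- The number `k_{ij} = f(s_i, s_j) · 2 cos (π / m_{ij})` if `s_i` and `s_j` are joined by an edge,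
and `0` otherwise.  When `m_{ij} = ∞` (encoded as `M i j = 0`) one has `π / 0 = 0` in Lean, so the
cosine is `1`, as it should be. -/
noncomputable def coeff (f : LegalWeight M) (i j : B) : ℂ :=
  if h : M.coxeterGraph.Adj i j then
    (f.weight ⟨(i, j), h⟩ : ℂ) * ((2 * Real.cos (Real.pi / (M i j : ℝ)) : ℝ) : ℂ)
  else 0

/-- The matrix `ω_i`: it differs from the identity matrix only in the `i`-th row, which has `-1` on
the diagonal and `k_{ij}` in the positions `(i, j)`, `j ≠ i`. -/
noncomputable def omega [DecidableEq B] (f : LegalWeight M) (i : B) : Matrix B B ℂ :=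
  Matrix.of fun r c =>
    if r = i then (if c = i then -1 else f.coeff i c) else (1 : Matrix B B ℂ) r c

theorem coeff_mul_coeff_symm (f : LegalWeight M) {i j : B} (hij : i ≠ j) :
    f.coeff i j * f.coeff j i = ((4 * Real.cos (Real.pi / (M i j : ℝ)) ^ 2 : ℝ) : ℂ) := by
  by_cases h : M.coxeterGraph.Adj i j
  · have hw : f.weight ⟨(j, i), h.symm⟩ = (f.weight ⟨(i, j), h⟩)⁻¹ := f.weight_symm ⟨(i, j), h⟩
    have hu : (f.weight ⟨(i, j), h⟩ : ℂ) * ((f.weight ⟨(i, j), h⟩)⁻¹ : ℂˣ) = 1 :=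
      Units.mul_inv _
    rw [coeff, coeff, dif_pos h, dif_pos h.symm, hw, M.symmetric j i]
    rw [Units.val_inv_eq_inv_val] at hu ⊢
    push_cast
    linear_combination (4 * Complex.cos (Real.pi / (M i j : ℂ)) ^ 2) * hu
  · have h2 : M i j = 2 := by
      by_contra h2
      exact h ⟨hij, h2⟩
    rw [coeff, dif_neg h, h2]
    simp

theorem coeff_eq_zero (f : LegalWeight M) {i j : B} (h : M i j = 2) : f.coeff i j = 0 := by
  rw [coeff, dif_neg]
  exact fun h' => h'.2 h

open Polynomial in
/-- The vanishing of the Chebyshev expressions governing the order of a product of two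
reflections. -/
theorem chebyshev_vanish {m : ℕ} (hm : 3 ≤ m) (t : ℂ)
    (ht : t = ((4 * Real.cos (Real.pi / (m : ℝ)) ^ 2 : ℝ) : ℂ) - 2) :
    ((Chebyshev.S ℂ ((m - 2 : ℤ) / 2)).eval t *
      ((Chebyshev.S ℂ ((m - 1 : ℤ) / 2)).eval t + (Chebyshev.S ℂ ((m - 3 : ℤ) / 2)).eval t) = 0) ∧
    ((Chebyshev.S ℂ ((m - 1 : ℤ) / 2)).eval t *
      ((Chebyshev.S ℂ ((m : ℤ) / 2)).eval t + (Chebyshev.S ℂ ((m - 2 : ℤ) / 2)).eval t) = 0) := by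
  have hm0 : (m : ℂ) ≠ 0 := by exact_mod_cast (by omega : m ≠ 0)
  have ht' : t = 2 * Complex.cos (2 * (Real.pi / (m : ℂ))) := by
    rw [ht, Complex.cos_two_mul]
    push_cast
    ring
  have hsin : Complex.sin (2 * (Real.pi / (m : ℂ))) ≠ 0 := by
    have h : 0 < Real.sin (2 * (Real.pi / (m : ℝ))) := by
      have hm3 : (3 : ℝ) ≤ m := by exact_mod_cast hm
      apply Real.sin_pos_of_pos_of_lt_pi
      · have := Real.pi_pos
        positivity
      · rw [← mul_div_assoc, div_lt_iff₀ (by linarith)]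
        nlinarith [Real.pi_pos]
    have h' : Complex.sin (2 * (Real.pi / (m : ℂ))) =
        ((Real.sin (2 * (Real.pi / (m : ℝ))) : ℝ) : ℂ) := by push_cast; rfl
    rw [h']
    exact_mod_cast h.ne'
  have key := fun n : ℤ => Chebyshev.S_two_mul_complex_cos (2 * (Real.pi / (m : ℂ))) n
  rw [← ht'] at key
  rcases Nat.even_or_odd' m with ⟨k, hk | hk⟩
  · have e1 : (m - 2 : ℤ) / 2 = k - 1 := by omega
    have e2 : (m - 1 : ℤ) / 2 = k - 1 := by omega
    have hz : (Chebyshev.S ℂ (k - 1 : ℤ)).eval t = 0 := by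
      have := key (k - 1)
      have harg : (((k - 1 : ℤ) : ℂ) + 1) * (2 * (Real.pi / (m : ℂ))) = Real.pi := by
        have hk' : (m : ℂ) = 2 * k := by exact_mod_cast hk
        have hk0 : (k : ℂ) ≠ 0 := by rintro h; apply hm0; rw [hk', h, mul_zero]
        rw [hk']
        push_cast
        field_simp
        ring
      rw [harg, Complex.sin_pi] at this
      exact (mul_eq_zero.mp this).resolve_right hsin
    rw [e1, e2, hz]
    simp
  · have e1 : (m - 2 : ℤ) / 2 = k - 1 := by omega
    have e2 : (m - 1 : ℤ) / 2 = k := by omega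
    have e3 : (m - 3 : ℤ) / 2 = k - 1 := by omega
    have e4 : (m : ℤ) / 2 = k := by omega
    have hz : (Chebyshev.S ℂ (k : ℤ)).eval t + (Chebyshev.S ℂ (k - 1 : ℤ)).eval t = 0 := by
      have h1 := key k
      have h2 := key (k - 1)
      have hk' : (m : ℂ) = 2 * k + 1 := by exact_mod_cast hk
      have harg : (((k : ℤ) : ℂ) + 1) * (2 * (Real.pi / (m : ℂ))) =
          2 * Real.pi - (((k - 1 : ℤ) : ℂ) + 1) * (2 * (Real.pi / (m : ℂ))) := by
        rw [hk'] at hm0 ⊢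
        have hx : (Real.pi / (2 * k + 1) : ℂ) * (2 * k + 1) = Real.pi := div_mul_cancel₀ _ hm0
        push_cast
        linear_combination 2 * hx
      rw [harg, Complex.sin_two_pi_sub] at h1
      have : ((Chebyshev.S ℂ (k : ℤ)).eval t + (Chebyshev.S ℂ (k - 1 : ℤ)).eval t) *
          Complex.sin (2 * (Real.pi / (m : ℂ))) = 0 := by
        rw [add_mul, h1, h2]
        ring
      exact (mul_eq_zero.mp this).resolve_right hsin
    rw [e1, e2, e3, e4, hz]
    simp

variable [Fintype B] [DecidableEq B]

/-- The linear form `v ↦ v_i - (ω_i v)_i`. -/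
noncomputable def form (f : LegalWeight M) (i : B) : Module.Dual ℂ (B → ℂ) :=
  LinearMap.proj i - (LinearMap.proj i).comp (Matrix.toLin' (f.omega i))

theorem form_single (f : LegalWeight M) (i j : B) :
    f.form i (Pi.single j 1) = if j = i then 2 else -f.coeff i j := by
  by_cases h : j = i
  · subst h
    simp [form, omega]
    norm_num
  · have h' : i ≠ j := fun e => h e.symm
    simp [form, omega, h, h']

theorem form_self (f : LegalWeight M) (i : B) : f.form i (Pi.single i 1) = 2 := by
  rw [form_single, if_pos rfl]

theorem toLin'_omega (f : LegalWeight M) (i : B) :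
    Matrix.toLin' (f.omega i) = (Module.reflection (f.form_self i)).toLinearMap := by
  ext j r
  simp only [LinearMap.comp_apply, LinearMap.single_apply, LinearEquiv.coe_coe,
    Module.reflection_apply, form_single]
  by_cases hr : r = i
  · subst hr
    by_cases hj : j = r
    · subst hj
      simp [omega]
      norm_num
    · have hj' : r ≠ j := fun e => hj e.symm
      simp [omega, hj, hj']
  · by_cases hj : j = i <;> simp [omega, hr, hj, Matrix.one_apply, Pi.single_apply]

/-- The matrices `ω_i` satisfy the Coxeter relations. -/
theorem isLiftable_omega (f : LegalWeight M) : M.IsLiftable f.omega := by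
  intro i j
  apply Matrix.toLin'.injective
  rw [Matrix.toLin'_pow, Matrix.toLin'_mul, toLin'_omega, toLin'_omega, Matrix.toLin'_one]
  suffices h : (Module.reflection (f.form_self i) * Module.reflection (f.form_self j)) ^ M i j
      = 1 by
    apply LinearMap.ext
    intro v
    have hv := congrArg (fun e : (B → ℂ) ≃ₗ[ℂ] (B → ℂ) => e v) h
    simp only [LinearEquiv.coe_pow, LinearEquiv.coe_one, id] at hv
    rw [Module.End.pow_apply]
    exact hv
  by_cases hij : i = j
  · subst hij
    rw [M.diagonal, pow_one]
    ext1 v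
    exact Module.involutive_reflection (f.form_self i) v
  have hji : j ≠ i := fun e => hij e.symm
  have hne1 : M i j ≠ 1 := M.off_diagonal i j hij
  have hf : f.form i (Pi.single j 1) = -f.coeff i j := by rw [form_single, if_neg hji]
  have hg : f.form j (Pi.single i 1) = -f.coeff j i := by rw [form_single, if_neg hij]
  rcases Nat.eq_zero_or_pos (M i j) with h0 | hpos
  · rw [h0, pow_zero]
  by_cases h2 : M i j = 2
  · rw [f.coeff_eq_zero h2, neg_zero] at hf
    rw [f.coeff_eq_zero (by rw [M.symmetric j i]; exact h2), neg_zero] at hg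
    rw [h2]
    ext1 v
    simp only [pow_two, LinearEquiv.mul_apply, Module.reflection_apply, map_sub, map_smul, hf, hg,
      form_self, LinearEquiv.coe_one, id]
    module
  · ext1 v
    have hvan := chebyshev_vanish (m := M i j) (by omega)
      (f.form i (Pi.single j 1) * f.form j (Pi.single i 1) - 2) (by
        rw [hf, hg, neg_mul_neg, f.coeff_mul_coeff_symm hij])
    rw [Module.reflection_mul_reflection_pow_apply (f.form_self i) (f.form_self j) (M i j) v,
      hvan.1, hvan.2]
    simp

/-- The generalized geometric representation of the Coxeter group `W` on `ℂ^n`: the homomorphism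
`W → GL_n(ℂ)` which sends each generator `s_i` to `ω_i`. -/
noncomputable def representation (f : LegalWeight M) {W : Type*} [Group W]
    (cs : CoxeterSystem M W) : W →* Matrix.GeneralLinearGroup B ℂ :=
  (cs.lift ⟨f.omega, f.isLiftable_omega⟩).toHomUnits

theorem representation_simple (f : LegalWeight M) {W : Type*} [Group W]
    (cs : CoxeterSystem M W) (i : B) :
    (f.representation cs (cs.simple i) : Matrix B B ℂ) = f.omega i := by
  simp [representation]

end LegalWeight

/-! If the graph is balanced, the weights come from a potential: `g i = f(i, j) * g j` on every
edge. In the basis `g i • e_i` the representation becomes the classical geometric one, where an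
element that gets longer under right multiplication by `s` sends the simple root of `s` to a
nonnegative combination of simple roots. An element of the kernel with a right descent would make a
simple root both positive and negative.

If the graph is not balanced, a shortest closed walk of weight different from `1` is a chordless
cycle: a vertex `z` and an induced path `p` from `a` to `b`. Let `r` be the reflection obtained by
conjugating `s_b` along `p`. Its root pairs with `e_z` to `-(f(z, a) * wt(p) + f(z, b))`. This is
`0` because the cycle has weight `-1`, so the images of `r` and `s_z` commute. With all weights `1`
the pairing is `-2` and the images do not commute; hence `r` and `s_z` do not commute in `W`, and
the representation is not faithful (`not_injective_representation`). -/

namespace LegalWeight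

/-! ### Weights of walks, signs and potentials. -/

section Walks

variable {B : Type*} {M : CoxeterMatrix B} (f : LegalWeight M)

theorem weight_swap {i j : B} (h : M.coxeterGraph.Adj i j) :
    f.weight ⟨(j, i), h.symm⟩ = (f.weight ⟨(i, j), h⟩)⁻¹ :=
  f.weight_symm ⟨(i, j), h⟩

@[simp]
theorem walkWeight_nil (i : B) :
    f.walkWeight (SimpleGraph.Walk.nil : M.coxeterGraph.Walk i i) = 1 := by
  simp [walkWeight]

@[simp]
theorem walkWeight_cons {i j k : B} (h : M.coxeterGraph.Adj i j) (p : M.coxeterGraph.Walk j k) :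
    f.walkWeight (SimpleGraph.Walk.cons h p) = f.weight ⟨(i, j), h⟩ * f.walkWeight p := by
  simp [walkWeight]

@[simp]
theorem walkWeight_append {i j k : B} (p : M.coxeterGraph.Walk i j)
    (q : M.coxeterGraph.Walk j k) :
    f.walkWeight (p.append q) = f.walkWeight p * f.walkWeight q := by
  simp [walkWeight]

@[simp]
theorem walkWeight_reverse {i j : B} (p : M.coxeterGraph.Walk i j) :
    f.walkWeight p.reverse = (f.walkWeight p)⁻¹ := by
  induction p with
  | nil => simp
  | cons h p ih =>
    simp [ih, f.weight_swap h, mul_comm]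

theorem walkWeight_eq_neg_one_pow (hf : f.IsSigned) {i j : B} (p : M.coxeterGraph.Walk i j) :
    f.walkWeight p = (-1) ^ f.negCount p := by
  classical
  induction p with
  | nil => simp [negCount]
  | @cons i j _ h p ih =>
    rw [walkWeight_cons, ih, negCount, negCount, SimpleGraph.Walk.darts_cons, List.countP_cons]
    have hne : (1 : ℂˣ) ≠ -1 := by
      intro e
      have := congrArg Units.val e
      norm_num at this
    rcases hf.2 ⟨(i, j), h⟩ with h1 | h1 <;> simp [h1, hne, pow_succ]

theorem walkWeight_eq_one_iff_even (hf : f.IsSigned) {i j : B} (p : M.coxeterGraph.Walk i j) :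
    f.walkWeight p = 1 ↔ Even (f.negCount p) := by
  have hne : (-1 : ℂˣ) ≠ 1 := by
    intro e
    have := congrArg Units.val e
    norm_num at this
  rw [walkWeight_eq_neg_one_pow f hf]
  rcases Nat.even_or_odd (f.negCount p) with h | h
  · simp [h.neg_one_pow, h]
  · simp [h.neg_one_pow, hne, h]

/-- The cosine factor disappears because `2 cos (π / 3) = 1`. -/
theorem coeff_of_adj (hM : M.IsSimplyLaced) {i j : B} (h : M.coxeterGraph.Adj i j) :
    f.coeff i j = f.weight ⟨(i, j), h⟩ := by
  rw [coeff, dif_pos h, (hM i j h.1).resolve_left h.2]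
  simp

theorem coeff_of_not_adj {i j : B} (h : ¬ M.coxeterGraph.Adj i j) : f.coeff i j = 0 := by
  rw [coeff, dif_neg h]

theorem coeff_comm (hf : f.IsSigned) (i j : B) : f.coeff i j = f.coeff j i := by
  by_cases h : M.coxeterGraph.Adj i j
  · rw [coeff_of_adj f hf.1 h, coeff_of_adj f hf.1 h.symm]
    rw [f.weight_swap h]
    rcases hf.2 ⟨(i, j), h⟩ with h1 | h1 <;> simp [h1]
  · rw [coeff_of_not_adj f h, coeff_of_not_adj f fun h' => h h'.symm]

/-- In a balanced graph the weights come from a potential on the vertices. -/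
theorem IsBalanced.exists_potential {f : LegalWeight M} (hb : f.IsBalanced) :
    ∃ g : B → ℂˣ, ∀ (i j : B) (h : M.coxeterGraph.Adj i j), g i = f.weight ⟨(i, j), h⟩ * g j := by
  -- The potential at `i` is the weight of any walk from `i` to a base vertex `r i` of its
  -- component; balance makes it independent of the walk.
  let r : B → B := fun i => (M.coxeterGraph.connectedComponentMk i).out
  have hr : ∀ i, M.coxeterGraph.Reachable i (r i) := fun i =>
    (SimpleGraph.ConnectedComponent.exact (Quot.out_eq (M.coxeterGraph.connectedComponentMk i))).symm
  have hu : ∀ {i j : B} (p q : M.coxeterGraph.Walk i j), f.walkWeight p = f.walkWeight q := by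
    intro i j p q
    have := hb i (p.append q.reverse)
    rwa [walkWeight_append, walkWeight_reverse, mul_inv_eq_one] at this
  refine ⟨fun i => f.walkWeight (hr i).some, fun i j h => ?_⟩
  have e : r j = r i := congrArg Quot.out (SimpleGraph.ConnectedComponent.sound h.reachable.symm)
  have hc : f.walkWeight ((hr j).some.copy rfl e) = f.walkWeight (hr j).some := by
    simp [walkWeight]
  change f.walkWeight (hr i).some = f.weight _ * f.walkWeight (hr j).some
  rw [← hc, ← walkWeight_cons]
  exact hu _ _

end Walks

/-! ### Shortest unbalanced closed walks are chordless cycles. -/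

section Chordless

variable {B : Type*} {M : CoxeterMatrix B} (f : LegalWeight M)

/-- Each vertex of the walk is different from all later ones, and adjacent to the next one only. -/
def _root_.SimpleGraph.Walk.IsInducedPath {V : Type*} {G : SimpleGraph V} :
    ∀ {u v : V}, G.Walk u v → Prop
  | _, _, .nil => True
  | _, _, .cons (u := u) (v := v) _ p =>
    p.IsInducedPath ∧ u ∉ p.support ∧ ∀ x ∈ p.support, G.Adj u x → x = v

theorem _root_.SimpleGraph.Walk.IsInducedPath.isPath {V : Type*} {G : SimpleGraph V} {u v : V}
    {p : G.Walk u v} (hp : p.IsInducedPath) : p.IsPath := by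
  induction p with
  | nil => simp
  | cons h p ih => exact (SimpleGraph.Walk.cons_isPath_iff h p).mpr ⟨ih hp.1, hp.2.1⟩

/-- Replacing a segment of the walk by a shorter walk with the same ends gives a closed walk
(segment and replacement together) of length at least `N`. -/
def _root_.SimpleGraph.Walk.NoShortcut {V : Type*} {G : SimpleGraph V} (N : ℕ) {u v : V}
    (p : G.Walk u v) : Prop :=
  ∀ (x y : V) (q₁ : G.Walk u x) (q₂ : G.Walk x y) (q₃ : G.Walk y v),
    p = q₁.append (q₂.append q₃) → ∀ e : G.Walk x y, e.length < q₂.length →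
      N ≤ e.length + q₂.length

theorem _root_.SimpleGraph.Walk.NoShortcut.of_cons {V : Type*} {G : SimpleGraph V} {N : ℕ}
    {u v w : V} {h : G.Adj u v} {p : G.Walk v w} (hp : (SimpleGraph.Walk.cons h p).NoShortcut N) :
    p.NoShortcut N := by
  intro x y q₁ q₂ q₃ hq
  exact hp x y (.cons h q₁) q₂ q₃ (by rw [hq, SimpleGraph.Walk.cons_append])

theorem _root_.SimpleGraph.Walk.NoShortcut.of_append {V : Type*} {G : SimpleGraph V} {N : ℕ}
    {u v w : V} {p : G.Walk u v} {q : G.Walk v w} (hp : (p.append q).NoShortcut N) :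
    p.NoShortcut N := by
  intro x y q₁ q₂ q₃ hq
  exact hp x y q₁ q₂ (q₃.append q) (by simp only [hq, SimpleGraph.Walk.append_assoc])

/-- A repeated vertex is a shortcut of length `0` and a chord is one of length `1`; either would
close up a segment to length at most `p.length + 1 < N`. -/
theorem _root_.SimpleGraph.Walk.NoShortcut.isInducedPath {V : Type*} {G : SimpleGraph V} {N : ℕ}
    {u v : V} {p : G.Walk u v} (hp : p.NoShortcut N) (hN : p.length + 1 < N) :
    p.IsInducedPath := by
  induction p with
  | nil => trivial
  | @cons u v w h p ih =>
    rw [SimpleGraph.Walk.length_cons] at hN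
    refine ⟨ih hp.of_cons (by omega), fun hu => ?_, fun x hx hux => ?_⟩
    · obtain ⟨q, r, rfl⟩ := SimpleGraph.Walk.mem_support_iff_exists_append.mp hu
      have := hp u u .nil (.cons h q) r (by simp) .nil (by simp)
      simp at this hN
      omega
    · obtain ⟨q, r, rfl⟩ := SimpleGraph.Walk.mem_support_iff_exists_append.mp hx
      cases q with
      | nil => rfl
      | cons h' q =>
        have := hp u x .nil (.cons h (.cons h' q)) r (by simp) (.cons hux .nil) (by simp)
        simp at this hN
        omega

/-- A shortcut `e` splits the closed walk into two. If both were shorter than `N` they would have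
weight `1`, and so would the original walk. -/
theorem noShortcut_of_minimal {N : ℕ}
    (hmin : ∀ (i : B) (p : M.coxeterGraph.Walk i i), p.length < N → f.walkWeight p = 1)
    {i : B} {p : M.coxeterGraph.Walk i i} (hp : f.walkWeight p ≠ 1) (hN : p.length = N) :
    p.NoShortcut N := by
  intro x y q₁ q₂ q₃ hq e he
  by_contra! hlt
  have h1 := hmin x (e.append q₂.reverse) (by simpa using hlt)
  have h2 := hmin i (q₁.append (e.append q₃)) (by
    rw [← hN, hq]
    simp only [SimpleGraph.Walk.length_append]
    omega)
  rw [walkWeight_append, walkWeight_reverse, mul_inv_eq_one] at h1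
  apply hp
  rw [hq, walkWeight_append, walkWeight_append, ← h1, ← walkWeight_append, ← walkWeight_append, h2]

/-- An unbalanced graph contains a chordless cycle of weight different from `1`. -/
theorem exists_chordless_cycle (hb : ¬ f.IsBalanced) :
    ∃ (z a b : B) (p : M.coxeterGraph.Walk a b) (ha : M.coxeterGraph.Adj z a)
      (hb : M.coxeterGraph.Adj b z), a ≠ b ∧ p.IsInducedPath ∧ z ∉ p.support ∧
      (∀ x ∈ p.support, M.coxeterGraph.Adj z x → x = a ∨ x = b) ∧
      f.walkWeight (.cons ha (p.concat hb)) ≠ 1 := by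
  classical
  have hex : ∃ N, ∃ (i : B) (p : M.coxeterGraph.Walk i i), p.length = N ∧ f.walkWeight p ≠ 1 := by
    simp only [IsBalanced, not_forall] at hb
    obtain ⟨i, p, hp⟩ := hb
    exact ⟨_, i, p, rfl, hp⟩
  obtain ⟨z, q, hq, hw⟩ := Nat.find_spec hex
  have hmin : ∀ (i : B) (p : M.coxeterGraph.Walk i i), p.length < Nat.find hex →
      f.walkWeight p = 1 := by
    intro i p hp
    by_contra h
    exact Nat.find_min hex hp ⟨i, p, rfl, h⟩
  generalize Nat.find hex = N at hq hmin
  have hns := noShortcut_of_minimal f hmin hw hq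
  cases q with
  | nil => simp at hw
  | @cons _ a _ ha q =>
    induction q using SimpleGraph.Walk.concatRec with
    | Hnil => exact absurd ha (SimpleGraph.irrefl _)
    | @Hconcat a b z p hb _ =>
      simp only [SimpleGraph.Walk.concat_eq_append, SimpleGraph.Walk.length_cons,
        SimpleGraph.Walk.length_append, SimpleGraph.Walk.length_nil] at hq
      have hns' : p.NoShortcut N := by
        rw [SimpleGraph.Walk.concat_eq_append] at hns
        exact hns.of_cons.of_append
      refine ⟨z, a, b, p, ha, hb, ?_, hns'.isInducedPath (by omega), fun hz => ?_, ?_, hw⟩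
      -- If `a = b`, the two outer edges are mutually inverse and cancel, leaving the shorter closed
      -- walk `p`.
      · rintro rfl
        apply hw
        have h1 := hmin _ p (by omega)
        simp [SimpleGraph.Walk.concat_eq_append, h1, f.weight_swap ha]
      · obtain ⟨q, r, rfl⟩ := SimpleGraph.Walk.mem_support_iff_exists_append.mp hz
        have := hns z z .nil (.cons ha q) (r.concat hb)
          (by simp [SimpleGraph.Walk.concat_eq_append, SimpleGraph.Walk.append_assoc]) .nil (by simp)
        simp at this hq
        omega
      · intro x hx hzx
        obtain ⟨q, r, rfl⟩ := SimpleGraph.Walk.mem_support_iff_exists_append.mp hx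
        cases q with
        | nil => exact Or.inl rfl
        | cons h' q =>
          cases r with
          | nil => exact Or.inr rfl
          | cons h'' r =>
            have := hns z x .nil (.cons ha (.cons h' q)) ((SimpleGraph.Walk.cons h'' r).concat hb)
              (by simp [SimpleGraph.Walk.concat_eq_append, ← SimpleGraph.Walk.append_assoc])
              (.cons hzx .nil) (by simp)
            simp at this hq
            omega

theorem isBalanced_iff_forall_isCycle :
    f.IsBalanced ↔
      ∀ (i : B) (c : M.coxeterGraph.Walk i i), c.IsCycle → f.walkWeight c = 1 := by
  refine ⟨fun h i c _ => h i c, fun h => ?_⟩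
  by_contra hb
  obtain ⟨z, a, b, p, ha, hb, hab, hp, hz, -, hw⟩ := f.exists_chordless_cycle hb
  refine hw (h z _ ((SimpleGraph.Walk.cons_isCycle_iff _ _).mpr ⟨?_, ?_⟩))
  · exact hp.isPath.concat hz hb
  · simp only [SimpleGraph.Walk.edges_concat, List.concat_eq_append, List.mem_append,
      List.mem_singleton, not_or]
    refine ⟨fun he => hz (p.fst_mem_support_of_mem_edges he), fun he => ?_⟩
    rw [Sym2.eq_swap, Sym2.eq_iff] at he
    rcases he with ⟨he, -⟩ | ⟨he, he'⟩
    · exact hab he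
    · exact hb.ne he'.symm

end Chordless

/-! ### Positivity of roots and faithfulness in the balanced case. -/

section Representation

variable {B : Type*} [Fintype B] [DecidableEq B] {M : CoxeterMatrix B} (f : LegalWeight M)
  {W : Type*} [Group W] (cs : CoxeterSystem M W)

theorem omega_mulVec (i : B) (v : B → ℂ) :
    (f.omega i).mulVec v = v - f.form i v • Pi.single i 1 := by
  rw [← Matrix.toLin'_apply, toLin'_omega]
  simp [Module.reflection_apply]

theorem form_single_of_ne {i j : B} (h : j ≠ i) : f.form i (Pi.single j 1) = -f.coeff i j := by
  rw [form_single, if_neg h]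

theorem representation_mul_mulVec (w w' : W) (v : B → ℂ) :
    (f.representation cs (w * w') : Matrix B B ℂ).mulVec v =
      (f.representation cs w : Matrix B B ℂ).mulVec
        ((f.representation cs w' : Matrix B B ℂ).mulVec v) := by
  simp

theorem representation_simple_mulVec (i : B) (v : B → ℂ) :
    (f.representation cs (cs.simple i) : Matrix B B ℂ).mulVec v =
      v - f.form i v • Pi.single i 1 := by
  rw [representation_simple, omega_mulVec]

theorem representation_simple_mulVec_self (i : B) :
    (f.representation cs (cs.simple i) : Matrix B B ℂ).mulVec (Pi.single i 1) =
      -Pi.single i 1 := by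
  rw [representation_simple_mulVec, form_self]
  module

theorem representation_simple_mulVec_of_ne {i j : B} (h : j ≠ i) :
    (f.representation cs (cs.simple i) : Matrix B B ℂ).mulVec (Pi.single j 1) =
      Pi.single j 1 + f.coeff i j • Pi.single i 1 := by
  rw [representation_simple_mulVec, form_single_of_ne f h]
  module

/-- An element `w` with `ℓ w < ℓ (w s)` sends the simple root of `s` to a positive root, up to the
potential `g`. -/
theorem exists_nat_of_length_lt (hM : M.IsSimplyLaced) {g : B → ℂˣ}
    (hg : ∀ (i j : B) (h : M.coxeterGraph.Adj i j), g i = f.weight ⟨(i, j), h⟩ * g j)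
    (w : W) (s : B) (hs : cs.length w < cs.length (w * cs.simple s)) :
    ∃ n : B → ℕ, (f.representation cs w : Matrix B B ℂ).mulVec ((g s : ℂ) • Pi.single s 1) =
      fun i => (g i : ℂ) * n i := by
  induction hl : cs.length w using Nat.strong_induction_on generalizing w s with
  | _ l ih =>
    subst hl
    by_cases hw : w = 1
    · subst hw
      refine ⟨Pi.single s 1, ?_⟩
      ext i
      by_cases hi : i = s
      · subst hi
        simp
      · simp [hi]
    obtain ⟨t, ht⟩ := cs.exists_rightDescent_of_ne_one hw
    rw [CoxeterSystem.isRightDescent_iff] at ht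
    have hts : s ≠ t := by
      rintro rfl
      omega
    obtain ⟨v, rfl⟩ : ∃ v, w = v * cs.simple t :=
      ⟨w * cs.simple t, by rw [cs.simple_mul_simple_cancel_right]⟩
    rw [cs.simple_mul_simple_cancel_right] at ht
    have hpow := cs.simple_mul_simple_pow s t
    by_cases hadj : M.coxeterGraph.Adj t s
    · have hco := coeff_of_adj f hM hadj
      have hgt : (g t : ℂ) = f.weight ⟨(t, s), hadj⟩ * g s := by
        rw [hg t s hadj, Units.val_mul]
      have hgs : (g s : ℂ) = f.weight ⟨(s, t), hadj.symm⟩ * g t := by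
        rw [hg s t hadj.symm, Units.val_mul]
      have hact : (f.representation cs (cs.simple t) : Matrix B B ℂ).mulVec
          ((g s : ℂ) • Pi.single s 1) = (g s : ℂ) • Pi.single s 1 + (g t : ℂ) • Pi.single t 1 := by
        rw [Matrix.mulVec_smul, representation_simple_mulVec_of_ne f cs hts, hco, hgt]
        module
      rw [representation_mul_mulVec, hact]
      -- If `s` lengthens `v`, induction applies to both summands. Otherwise `v = u s`, and `s`
      -- sends the sum of the two rescaled simple roots to that of `t`, which leaves `u` acting on
      -- the root of `t`.
      rcases cs.length_mul_simple v s with hvs | hvs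
      · obtain ⟨n, hn⟩ := ih _ (by omega) v s (by omega) rfl
        obtain ⟨n', hn'⟩ := ih _ (by omega) v t (by omega) rfl
        refine ⟨n + n', ?_⟩
        rw [Matrix.mulVec_add, hn, hn']
        ext i
        simp [mul_add]
      · obtain ⟨u, rfl⟩ : ∃ u, v = u * cs.simple s :=
          ⟨v * cs.simple s, by rw [cs.simple_mul_simple_cancel_right]⟩
        rw [cs.simple_mul_simple_cancel_right] at hvs
        have hM3 : M s t = 3 := (hM s t hts).resolve_left hadj.symm.2
        have hbraid : cs.simple s * cs.simple t * cs.simple s =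
            cs.simple t * cs.simple s * cs.simple t := by
          rw [hM3] at hpow
          apply mul_right_cancel (b := cs.simple t * cs.simple s * cs.simple t)
          rw [pow_succ, pow_two] at hpow
          simp only [mul_assoc] at hpow ⊢
          rw [hpow]
          simp
        -- Otherwise `u s t s = (u t) s t` would have length at most `ℓ u + 1`, whereas it is `ℓ u +
        -- 3`.
        have hut : cs.length u < cs.length (u * cs.simple t) := by
          rcases cs.length_mul_simple u t with h | h
          · omega
          · exfalso
            have e : u * cs.simple s * cs.simple t * cs.simple s =
                u * cs.simple t * (cs.simple s * cs.simple t) := by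
              rw [mul_assoc u, mul_assoc u, hbraid]
              simp only [mul_assoc]
            rw [e] at hs
            have h1 := cs.length_mul_le (u * cs.simple t) (cs.simple s * cs.simple t)
            have h2 := cs.length_mul_le (cs.simple s) (cs.simple t)
            rw [cs.length_simple, cs.length_simple] at h2
            omega
        obtain ⟨n, hn⟩ := ih _ (by omega) u t hut rfl
        refine ⟨n, ?_⟩
        rw [representation_mul_mulVec, ← hn]
        congr 1
        rw [Matrix.mulVec_add, Matrix.mulVec_smul, Matrix.mulVec_smul,
          representation_simple_mulVec_self, representation_simple_mulVec_of_ne f cs hts.symm,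
          coeff_of_adj f hM hadj.symm, hgs]
        module
    · have hM2 : M s t = 2 := by
        by_contra h
        exact hadj (SimpleGraph.Adj.symm ⟨hts, h⟩)
      have hcomm : cs.simple s * cs.simple t = cs.simple t * cs.simple s := by
        rw [hM2, pow_two] at hpow
        rw [eq_inv_of_mul_eq_one_left hpow]
        simp
      have hvs : cs.length v < cs.length (v * cs.simple s) := by
        rcases cs.length_mul_simple v s with h | h
        · omega
        · exfalso
          rw [mul_assoc, ← hcomm, ← mul_assoc] at hs
          have h1 := cs.length_mul_le (v * cs.simple s) (cs.simple t)
          rw [cs.length_simple] at h1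
          omega
      obtain ⟨n, hn⟩ := ih _ (by omega) v s hvs rfl
      refine ⟨n, ?_⟩
      rw [representation_mul_mulVec, ← hn, Matrix.mulVec_smul,
        representation_simple_mulVec_of_ne f cs hts, coeff_of_not_adj f hadj]
      simp

theorem IsBalanced.injective_representation {f : LegalWeight M} (hM : M.IsSimplyLaced)
    (hb : f.IsBalanced) : Function.Injective (f.representation cs) := by
  obtain ⟨g, hg⟩ := hb.exists_potential
  rw [injective_iff_map_eq_one]
  intro w hw
  by_contra hne
  obtain ⟨s, hs⟩ := cs.exists_rightDescent_of_ne_one hne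
  rw [CoxeterSystem.isRightDescent_iff] at hs
  obtain ⟨n, hn⟩ := f.exists_nat_of_length_lt cs hM hg (w * cs.simple s) s (by
    rw [cs.simple_mul_simple_cancel_right]
    omega)
  -- With `w` acting trivially, the `s`-coordinate of the image of the root is `-g s`, forcing `n s
  -- = -1`.
  rw [representation_mul_mulVec, hw, Matrix.mulVec_smul, representation_simple_mulVec_self] at hn
  have h := congrFun hn s
  simp only [Units.val_one, Matrix.one_mulVec, Pi.smul_apply, Pi.neg_apply, Pi.single_eq_same,
    smul_eq_mul] at h
  have h' := mul_left_cancel₀ (g s).ne_zero h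
  have h'' : ((n s + 1 : ℕ) : ℂ) = 0 := by
    push_cast
    rw [← h']
    ring
  exact absurd (Nat.cast_eq_zero.mp h'') (by omega)

end Representation

/-! ### Reflections along induced paths and non-faithfulness in the unbalanced case. -/

section PathReflection

variable {B : Type*} [DecidableEq B] {M : CoxeterMatrix B} (f : LegalWeight M)

/-- The root of the reflection `pathElement p`. -/
noncomputable def pathRoot : ∀ {a b : B}, M.coxeterGraph.Walk a b → (B → ℂ)
  | a, _, .nil => Pi.single a 1
  | a, _, .cons h p =>
    pathRoot p + (f.walkWeight (.cons h p) : ℂ) • Pi.single a 1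

/-- The linear form of the reflection `pathElement p`. -/
noncomputable def pathForm [Fintype B] :
    ∀ {a b : B}, M.coxeterGraph.Walk a b → Module.Dual ℂ (B → ℂ)
  | a, _, .nil => f.form a
  | a, _, .cons h p =>
    pathForm p + (f.walkWeight (.cons h p) : ℂ) • f.form a

/-- The element `s₁ ⋯ sₖ₋₁ sₖ sₖ₋₁ ⋯ s₁` for the walk with vertices `s₁, …, sₖ`. -/
def pathElement {W : Type*} [Group W] (cs : CoxeterSystem M W) :
    ∀ {a b : B}, M.coxeterGraph.Walk a b → W
  | a, _, .nil => cs.simple a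
  | a, _, .cons _ p => cs.simple a * pathElement cs p * cs.simple a

theorem pathRoot_apply_of_notMem {a b z : B} (p : M.coxeterGraph.Walk a b) (hz : z ∉ p.support) :
    f.pathRoot p z = 0 := by
  induction p with
  | nil =>
    simp only [SimpleGraph.Walk.support_nil, List.mem_singleton] at hz
    simp [pathRoot, hz]
  | cons h p ih =>
    simp only [SimpleGraph.Walk.support_cons, List.mem_cons, not_or] at hz
    simp [pathRoot, ih hz.2, hz.1]

variable [Fintype B]

theorem form_pathRoot_of_not_adj {a b z : B} (p : M.coxeterGraph.Walk a b) (hz : z ∉ p.support)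
    (hadj : ∀ x ∈ p.support, ¬ M.coxeterGraph.Adj z x) : f.form z (f.pathRoot p) = 0 := by
  induction p with
  | @nil u =>
    simp only [SimpleGraph.Walk.support_nil, List.mem_singleton, forall_eq] at hz hadj
    rw [pathRoot, form_single_of_ne f (Ne.symm hz), coeff_of_not_adj f hadj, neg_zero]
  | @cons u v w h p ih =>
    simp only [SimpleGraph.Walk.support_cons, List.mem_cons, not_or, forall_eq_or_imp] at hz hadj
    rw [pathRoot, map_add, map_smul, ih hz.2 hadj.2, form_single_of_ne f (Ne.symm hz.1),
      coeff_of_not_adj f hadj.1]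
    simp

theorem form_pathRoot_of_adj_start {a b z : B} {p : M.coxeterGraph.Walk a b} (hp : p.IsPath)
    (hz : z ∉ p.support) (hadj : ∀ x ∈ p.support, M.coxeterGraph.Adj z x → x = a) :
    f.form z (f.pathRoot p) = -(f.coeff z a * f.walkWeight p) := by
  cases p with
  | nil =>
    simp only [SimpleGraph.Walk.support_nil, List.mem_singleton] at hz
    simp [pathRoot, form_single_of_ne f (Ne.symm hz)]
  | cons h p =>
    simp only [SimpleGraph.Walk.support_cons, List.mem_cons, not_or, forall_eq_or_imp] at hz hadj
    have ha := ((SimpleGraph.Walk.cons_isPath_iff h p).mp hp).2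
    rw [pathRoot, map_add, map_smul, form_single_of_ne f (Ne.symm hz.1),
      form_pathRoot_of_not_adj f p hz.2 fun x hx hx' => ha (hadj.2 x hx hx' ▸ hx), smul_eq_mul]
    ring

theorem form_pathRoot_of_adj_end {a b z : B} {p : M.coxeterGraph.Walk a b} (hp : p.IsPath)
    (hz : z ∉ p.support) (hadj : ∀ x ∈ p.support, M.coxeterGraph.Adj z x → x = b) :
    f.form z (f.pathRoot p) = -f.coeff z b := by
  induction p with
  | nil =>
    simp only [SimpleGraph.Walk.support_nil, List.mem_singleton] at hz
    simp [pathRoot, form_single_of_ne f (Ne.symm hz)]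
  | cons h p ih =>
    simp only [SimpleGraph.Walk.support_cons, List.mem_cons, not_or, forall_eq_or_imp] at hz hadj
    have ha := (SimpleGraph.Walk.cons_isPath_iff h p).mp hp
    rw [pathRoot, map_add, map_smul, form_single_of_ne f (Ne.symm hz.1), ih ha.1 hz.2 hadj.2,
      coeff_of_not_adj f fun h' => ha.2 (hadj.1 h' ▸ p.end_mem_support)]
    simp

/-- Only the neighbours of `z` contribute, and the coefficient of `pathRoot` at a vertex of the path
is the weight of the rest of the path: all of `p` at `a`, and `1` at `b`. -/
theorem form_pathRoot_of_adj_ends {a b z : B} {p : M.coxeterGraph.Walk a b} (hp : p.IsPath)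
    (hab : a ≠ b) (hz : z ∉ p.support)
    (hadj : ∀ x ∈ p.support, M.coxeterGraph.Adj z x → x = a ∨ x = b) :
    f.form z (f.pathRoot p) = -(f.coeff z a * f.walkWeight p + f.coeff z b) := by
  cases p with
  | nil => exact absurd rfl hab
  | cons h p =>
    simp only [SimpleGraph.Walk.support_cons, List.mem_cons, not_or, forall_eq_or_imp] at hz hadj
    have ha := (SimpleGraph.Walk.cons_isPath_iff h p).mp hp
    rw [pathRoot, map_add, map_smul, form_single_of_ne f (Ne.symm hz.1),
      form_pathRoot_of_adj_end f ha.1 hz.2 fun x hx hx' =>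
        (hadj.2 x hx hx').resolve_left fun e => ha.2 (e ▸ hx), smul_eq_mul]
    ring

theorem pathForm_single (hf : f.IsSigned) {a b : B} (p : M.coxeterGraph.Walk a b) (j : B) :
    f.pathForm p (Pi.single j 1) = f.form j (f.pathRoot p) := by
  have hsymm : ∀ i, f.form i (Pi.single j 1) = f.form j (Pi.single i 1) := by
    intro i
    rw [form_single, form_single, coeff_comm f hf]
    simp only [eq_comm]
  induction p with
  | nil => simp [pathForm, pathRoot, hsymm]
  | cons h p ih => simp [pathForm, pathRoot, ih, hsymm]

variable {W : Type*} [Group W] (cs : CoxeterSystem M W)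

/-- Conjugating a reflection by `s_u` applies `s_u` to its root. As the path is induced, `u` pairs
only with the next vertex, so exactly one new term appears; the form transforms alike since signs
make the coefficients symmetric. -/
theorem representation_pathElement_mulVec (hf : f.IsSigned) {a b : B}
    {p : M.coxeterGraph.Walk a b} (hp : p.IsInducedPath) (x : B → ℂ) :
    (f.representation cs (pathElement cs p) : Matrix B B ℂ).mulVec x =
      x - f.pathForm p x • f.pathRoot p := by
  induction p generalizing x with
  | nil => rw [pathElement, representation_simple_mulVec, pathForm, pathRoot]
  | @cons u v w h p ih =>
    have hu := form_pathRoot_of_adj_start f hp.1.isPath hp.2.1 hp.2.2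
    rw [coeff_of_adj f hf.1 h, ← Units.val_mul, ← walkWeight_cons] at hu
    rw [pathElement, representation_mul_mulVec, representation_mul_mulVec, ih hp.1,
      representation_simple_mulVec, representation_simple_mulVec]
    simp only [map_sub, map_smul, pathForm_single f hf, form_self, hu, pathForm, pathRoot,
      LinearMap.add_apply, LinearMap.smul_apply, smul_eq_mul]
    module

theorem not_injective_representation (hf : f.IsSigned) (hb : ¬ f.IsBalanced) :
    ¬ Function.Injective (f.representation cs) := by
  intro hinj
  obtain ⟨z, a, b, p, ha, hb, hab, hp, hz, hadj, hw⟩ := f.exists_chordless_cycle hb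
  have hzero : f.form z (f.pathRoot p) = 0 := by
    rw [form_pathRoot_of_adj_ends f hp.isPath hab hz hadj, coeff_comm f hf z b,
      coeff_of_adj f hf.1 ha, coeff_of_adj f hf.1 hb]
    have h1 := hf.2 ⟨(z, a), ha⟩
    have h2 := hf.2 ⟨(b, z), hb⟩
    have h3 : f.walkWeight p = 1 ∨ f.walkWeight p = -1 := by
      rw [walkWeight_eq_neg_one_pow f hf]
      exact neg_one_pow_eq_or _ _
    rw [SimpleGraph.Walk.concat_eq_append, walkWeight_cons, walkWeight_append, walkWeight_cons,
      walkWeight_nil] at hw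
    rcases h1 with h1 | h1 <;> rcases h2 with h2 | h2 <;> rcases h3 with h3 | h3 <;>
      simp [h1, h2, h3] at hw ⊢
  have hcomm : pathElement cs p * cs.simple z = cs.simple z * pathElement cs p := by
    apply hinj
    apply Units.ext
    apply Matrix.toLin'.injective
    apply LinearMap.ext
    intro x
    rw [Matrix.toLin'_apply, Matrix.toLin'_apply, representation_mul_mulVec,
      representation_mul_mulVec, representation_pathElement_mulVec f cs hf hp,
      representation_pathElement_mulVec f cs hf hp, representation_simple_mulVec,
      representation_simple_mulVec]
    simp only [map_sub, map_smul, pathForm_single f hf, hzero, smul_eq_mul]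
    module
  -- The constant weight `1` gives a second representation of the same `W`. There the
  -- `z`-coordinates of the images of `e_z` under the two products are `-1` and `3`.
  let e : LegalWeight M := ⟨fun _ => 1, fun _ => by simp⟩
  have he : e.IsSigned := ⟨hf.1, fun _ => Or.inl rfl⟩
  have htwo : e.form z (e.pathRoot p) = -2 := by
    have h1 : e.walkWeight p = 1 := by simp [walkWeight, e]
    rw [form_pathRoot_of_adj_ends e hp.isPath hab hz hadj, coeff_comm e he z b,
      coeff_of_adj e he.1 ha, coeff_of_adj e he.1 hb, h1]
    simp only [e, Units.val_one]
    norm_num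
  have h := congrArg
    (fun w => (e.representation cs w : Matrix B B ℂ).mulVec (Pi.single z 1) z) hcomm
  simp only [representation_mul_mulVec, representation_pathElement_mulVec e cs he hp,
    representation_simple_mulVec, map_sub, map_smul, pathForm_single e he, htwo, form_self,
    Pi.sub_apply, Pi.smul_apply, Pi.single_eq_same, pathRoot_apply_of_notMem e p hz,
    smul_eq_mul] at h
  norm_num at h

end PathReflection

end LegalWeight

theorem mainTheorem1 {B : Type*} [Fintype B] [DecidableEq B] {M : CoxeterMatrix B}
    {W : Type*} [Group W] (cs : CoxeterSystem M W) (f : LegalWeight M) (hf : f.IsSigned) :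
    (Function.Injective (f.representation cs) ↔ f.IsBalanced) ∧
    (f.IsBalanced ↔
      ∀ (i : B) (c : M.coxeterGraph.Walk i i), c.IsCycle → f.walkWeight c = 1) ∧
    (f.IsBalanced ↔
      ∀ (i : B) (c : M.coxeterGraph.Walk i i), c.IsCycle → Even (f.negCount c)) := by
  refine ⟨⟨fun h => ?_, fun h => h.injective_representation cs hf.1⟩,
    f.isBalanced_iff_forall_isCycle, ?_⟩
  · by_contra hb
    exact f.not_injective_representation cs hf hb h
  · simp only [f.isBalanced_iff_forall_isCycle, f.walkWeight_eq_one_iff_even hf]
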